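/- Let $A(G)$ be the adjacency matrix of a finite simple graph $G$ on $n$ vertices, with eigenvalues $\lambda_1(G),\dots,\lambda_n(G)$, and let $S_k(G)=\sum_{i=1}^n\lambda_i(G)^k$ for $k=0,1,\dots,n-1$. For graphs $G_1,G_2$ on $n$ vertices write $G_1\prec_s G_2$ ($G_1$ comes before $G_2$ in the $S$-order) if for some $k\in\{1,\dots,n-1\}$ we have $S_i(G_1)=S_i(G_2)$ for $0\le i\le k-1$ and $S_k(G_1)<S_k(G_2)$. Let $\mathscr T_n^{p,q}$ be the set of trees on $n=p+q$ vertices whose vertex set has a bipartition into classes with $p$ and $q$ vertices. For $k,l\ge 0$ with $k+l+1\le p$ and $l+2\le q$, let $B_{p,q}^{k,l}\in\mathscr T_n^{p,q}$ be the tree with $p$ white and $q$ black vertices in which one white vertex $x$ is adjacent to all $q$ black vertices and the other $p-1$ white vertices are leaves: $p-1-k-l$ of them are attached to a black vertex $u$, $k$ of them to another black vertex $v$, and the remaining $l$ to $l$ further distinct black vertices, one to each. **Theorem.** Let $p=q$. (i) If $p\ge 5$, the last four trees, in the $S$-order, among $\mathscr T_n^{p,q}$ are, from fourth-last to last, $B_{p,q}^{0,2},\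 B_{p,q}^{2,0},\ B_{p,q}^{0,1},\ B_{p,q}^{0,0}$. That is, $B_{p,q}^{0,2}\prec_s B_{p,q}^{2,0}\prec_s B_{p,q}^{0,1}\prec_s B_{p,q}^{0,0}$, and $T\prec_s B_{p,q}^{0,2}$ for every $T\in\mathscr T_n^{p,q}$ that is isomorphic to none of these four trees. (ii) If $p=4$, then $B_{p,q}^{2,0}\cong B_{p,q}^{0,1}$, and in the same sense the last three trees, in the $S$-order, among $\mathscr T_n^{p,q}$ are, from third-last to last, $B_{p,q}^{0,2},\ B_{p,q}^{0,1},\ B_{p,q}^{0,0}$. -/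

import Mathlib

/-- The `k`-th spectral moment of a finite graph: the sum of the `k`-th powers of the
eigenvalues (with multiplicity) of its real adjacency matrix. -/
noncomputable def spectralMoment {V : Type*} [Fintype V] (G : SimpleGraph V) (k : ℕ) : ℝ := by
  classical
  exact ∑ i, (show (G.adjMatrix ℝ).IsHermitian from
    (Matrix.conjTranspose_eq_transpose_of_trivial _).trans
      (SimpleGraph.isSymm_adjMatrix G)).eigenvalues i ^ k

/-- `G` comes strictly before `H` in the `S`-order. The moments `S₀` are the numbers of vertices,
so only graphs with equally many vertices are comparable. -/
def SBefore {V W : Type*} [Fintype V] [Fintype W] (G : SimpleGraph V) (H : SimpleGraph W) : Prop :=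
  ∃ k : ℕ, 1 ≤ k ∧ k < Fintype.card V ∧
    (∀ i < k, spectralMoment G i = spectralMoment H i) ∧ spectralMoment G k < spectralMoment H k

/-- `G` is a tree with a `(p, q)`-bipartition. -/
def IsTreeWithBipartition (p q : ℕ) {V : Type*} [Fintype V] (G : SimpleGraph V) : Prop :=
  G.IsTree ∧ ∃ s t : Set V, G.IsBipartiteWith s t ∧ s ∪ t = Set.univ ∧ s.ncard = p ∧ t.ncard = q

/-- In `treeB p q k l`, the black vertex to which the `i`-th white vertex (`1 ≤ i`) is attached:
white vertices `1, …, k` hang on the black vertex `v = 1`; the next `l` white vertices hang on the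
`l` distinct black vertices `2, …, l + 1`; all the others hang on the black vertex `u = 0`. -/
def treeBAttach (k l i : ℕ) : ℕ :=
  if i ≤ k then 1 else if i ≤ k + l then i - k + 1 else 0

/-- The tree `B_{p,q}^{k,l}` with white vertices `Fin p` and black vertices `Fin q`
(meaningful for `k + l + 1 ≤ p` and `l + 2 ≤ q`). The white vertex `0` is joined to all black
vertices, `u` carries `p - 1 - k - l` white leaves, `v` carries `k` white leaves, and `l` further
black vertices carry one white leaf each. Thus `u` and `v` have degrees `p - k - l` and `k + 1`,
and the convention `deg v ≤ deg u` reads `2 * k + l + 1 ≤ p`. -/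
def treeB (p q k l : ℕ) : SimpleGraph (Fin p ⊕ Fin q) :=
  SimpleGraph.fromRel fun a b =>
    ∃ (i : Fin p) (j : Fin q), a = Sum.inl i ∧ b = Sum.inr j ∧
      ((i : ℕ) = 0 ∨ (j : ℕ) = treeBAttach k l i)

universe u

/-- The members of `L` are, in this order and up to isomorphism, the last `L.length` trees in the
`S`-order among all trees with a `(p, q)`-bipartition: they are such trees, each comes strictly
before all later ones, and every other such tree comes strictly before all of them. -/
def AreLastTrees (p q : ℕ) (L : List (SimpleGraph (Fin p ⊕ Fin q))) : Prop :=
  (∀ G ∈ L, IsTreeWithBipartition p q G) ∧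
  L.Pairwise (fun G H => SBefore G H) ∧
  ∀ (V : Type u) [Fintype V] (T : SimpleGraph V), IsTreeWithBipartition p q T →
    (∀ G ∈ L, ¬ Nonempty (T ≃g G)) → ∀ G ∈ L, SBefore T G

/-! Put p = q = m + 1 and call deg v - 1 the excess of v. Each side has m + 1 vertices and meets all
2m + 1 edges, so its total excess is m. The moments S_0, ..., S_3 agree for all these trees, and S_4
is an increasing affine function of the sum of squared excesses, because distinct vertices of a tree
have at most one common neighbour. So that sum is compared first.

Suppose some vertex is adjacent to the whole opposite side (a hub). Its side contributes m^2, and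
the tree is determined by the partition of m formed by the excesses on the other side
(`IsBalancedTree.nonempty_iso_of_hub`). The partitions (m), (m-1,1), (m-2,2), (m-2,1,1) give
B^{0,0}, B^{0,1}, B^{2,0}, B^{0,2}. Every other partition has square sum below (m-2)^2 + 2, except
(3,3) for m = 6, which ties with (4,1,1) (`hasProfile_or_sum_sq_le`). There S_6 decides: given a hub
and equal square sums it increases with the sum of cubes, and 54 < 66.

Without a hub each side contributes at most (m-1)^2 + 1 (`sum_sq_le_of_forall_lt`), and 2(m-1)^2 + 2
is two less than the total m^2 + (m-2)^2 + 2 of B^{0,2}. For m = 3 the partitions (m-1,1) and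
(m-2,2) coincide. -/

/-! ### Spectral moments as traces and degree sums. -/

section Moments

open Finset Matrix

variable {V : Type*} [Fintype V]

theorem Matrix.IsHermitian.trace_pow_eq_sum_eigenvalues {n : Type*} [Fintype n] [DecidableEq n]
    {A : Matrix n n ℝ} (hA : A.IsHermitian) (k : ℕ) :
    (A ^ k).trace = ∑ i, hA.eigenvalues i ^ k := by
  conv_lhs => rw [hA.spectral_theorem, ← map_pow, Unitary.conjStarAlgAut_apply, trace_mul_cycle]
  simp [diagonal_pow, trace_diagonal]

theorem spectralMoment_eq_trace [DecidableEq V] (G : SimpleGraph V) [DecidableRel G.Adj] (k : ℕ) :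
    spectralMoment G k = (G.adjMatrix ℝ ^ k).trace := by
  obtain rfl : ‹DecidableEq V› = fun a b => Classical.propDecidable (a = b) := Subsingleton.elim _ _
  unfold spectralMoment
  let _ : DecidableEq V := fun a b => Classical.propDecidable (a = b)
  refine (Matrix.IsHermitian.trace_pow_eq_sum_eigenvalues _ k).symm.trans ?_
  congr!

theorem spectralMoment_zero (G : SimpleGraph V) : spectralMoment G 0 = Fintype.card V := by
  classical
  rw [spectralMoment_eq_trace]
  simp

theorem spectralMoment_two (G : SimpleGraph V) [DecidableRel G.Adj] :
    spectralMoment G 2 = ∑ v, (G.degree v : ℝ) := by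
  classical
  rw [spectralMoment_eq_trace, pow_two]
  simp only [Matrix.trace, diag_apply, SimpleGraph.adjMatrix_mul_self_apply_self]

theorem spectralMoment_of_odd {G : SimpleGraph V} (hG : G.IsBipartite) {k : ℕ} (hk : Odd k) :
    spectralMoment G k = 0 := by
  classical
  rw [spectralMoment_eq_trace]
  refine Finset.sum_eq_zero fun v _ => ?_
  rw [diag_apply, SimpleGraph.adjMatrix_pow_apply_eq_card_walk, Nat.cast_eq_zero,
    Fintype.card_eq_zero_iff]
  refine ⟨fun w => ?_⟩
  have c : G.Coloring Bool := hG.toColoring (by simp)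
  have h2 := (c.odd_length_iff_not_congr w.1)
  rw [w.2] at h2
  simpa using h2.1 hk

theorem adjMatrix_sq_apply (G : SimpleGraph V) [DecidableEq V] [DecidableRel G.Adj] (u v : V) :
    (G.adjMatrix ℝ ^ 2) u v = #(G.neighborFinset u ∩ G.neighborFinset v) := by
  rw [pow_two, SimpleGraph.adjMatrix_mul_apply, ← Finset.filter_mem_eq_inter]
  simp [SimpleGraph.adjMatrix_apply, SimpleGraph.adj_comm]

/-- Two common neighbours would give two different paths of length 2 from `u` to `v`. -/
theorem SimpleGraph.IsAcyclic.card_inter_neighborFinset_le_one {G : SimpleGraph V} [DecidableEq V]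
    [DecidableRel G.Adj] (hG : G.IsAcyclic) {u v : V} (h : u ≠ v) :
    #(G.neighborFinset u ∩ G.neighborFinset v) ≤ 1 := by
  rw [Finset.card_le_one]
  intro a ha b hb
  simp only [Finset.mem_inter, SimpleGraph.mem_neighborFinset] at ha hb
  have key : ∀ c, (h1 : G.Adj u c) → (h2 : G.Adj v c) →
      (SimpleGraph.Walk.cons h1 (SimpleGraph.Walk.cons h2.symm SimpleGraph.Walk.nil)).IsPath := by
    intro c h1 h2
    simp [SimpleGraph.Walk.cons_isPath_iff, h1.ne, h2.ne.symm, h]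
  have := (hG.subsingleton_path u v).elim ⟨_, key a ha.1 ha.2⟩ ⟨_, key b hb.1 hb.2⟩
  simpa using congrArg (fun p : G.Path u v => p.1.support) this

theorem spectralMoment_four {G : SimpleGraph V} [DecidableRel G.Adj] (hG : G.IsAcyclic) :
    spectralMoment G 4 = 2 * ∑ v, (G.degree v : ℝ) ^ 2 - ∑ v, (G.degree v : ℝ) := by
  classical
  rw [spectralMoment_eq_trace, show 4 = 2 + 2 from rfl, pow_add]
  set c : V → V → ℝ := fun u v => #(G.neighborFinset u ∩ G.neighborFinset v) with hc
  have hcc : ∀ u v, c u v = c v u := fun u v => by simp [hc, Finset.inter_comm]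
  -- Off the diagonal `c` is 0 or 1, hence equal to its square; only the diagonal needs a
  -- correction.
  have h1 : ∀ u v, c u v * c v u = c u v + if u = v then ((G.degree u : ℝ) ^ 2 - G.degree u) else 0 := by
    intro u v
    rw [hcc v u]
    split_ifs with h
    · subst h
      simp only [hc, Finset.inter_self, SimpleGraph.card_neighborFinset_eq_degree]
      ring
    · have := hG.card_inter_neighborFinset_le_one h
      simp only [hc]
      interval_cases #(G.neighborFinset u ∩ G.neighborFinset v) <;> simp
  -- Count ordered pairs of neighbours by their common neighbour `w`.
  have h2 : ∑ u, ∑ v, c u v = ∑ w, (G.degree w : ℝ) ^ 2 := by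
    have : ∀ u v, c u v = ∑ w, if (G.Adj w u ∧ G.Adj w v) then 1 else 0 := by
      intro u v
      simp only [hc, Finset.sum_boole]
      congr 2
      ext w
      simp [SimpleGraph.adj_comm]
    simp_rw [this]
    rw [Finset.sum_congr rfl fun u _ => Finset.sum_comm, Finset.sum_comm]
    refine Finset.sum_congr rfl fun w _ => ?_
    have : ∀ u v, (if (G.Adj w u ∧ G.Adj w v) then (1 : ℝ) else 0) =
      (if G.Adj w u then 1 else 0) * (if G.Adj w v then 1 else 0) := by
      intro u v
      by_cases h : G.Adj w u <;> simp [h]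
    simp_rw [this, ← Finset.sum_mul_sum, Finset.sum_boole, ← pow_two]
    simp [← SimpleGraph.neighborFinset_eq_filter]
  simp only [Matrix.trace, diag_apply, Matrix.mul_apply, adjMatrix_sq_apply]
  change ∑ u, ∑ v, c u v * c v u = _
  simp_rw [h1, Finset.sum_add_distrib, h2]
  simp [Finset.sum_sub_distrib]
  ring

/-- In a bipartite graph, closed walks of even length are evenly split between the two sides. -/
theorem spectralMoment_six {G : SimpleGraph V} [DecidableEq V] [DecidableRel G.Adj] {s t : Finset V}
    (hG : G.IsBipartiteWith s t) (hst : s ∪ t = univ) :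
    spectralMoment G 6 = 2 * ∑ u ∈ t, ∑ v ∈ t, ∑ w ∈ t, (G.adjMatrix ℝ ^ 2) u v *
      (G.adjMatrix ℝ ^ 2) v w * (G.adjMatrix ℝ ^ 2) w u := by
  rw [spectralMoment_eq_trace]
  set A := G.adjMatrix ℝ with hA
  set P : Matrix V V ℝ := diagonal fun v => if v ∈ t then 1 else 0 with hP
  have hdisj : ∀ v, v ∈ s ↔ v ∉ t := by
    intro v
    have h1 : v ∈ s ∪ t := by rw [hst]; exact Finset.mem_univ v
    have h2 : v ∈ s → v ∉ t := fun h => Finset.disjoint_left.1 (Finset.disjoint_coe.1 hG.disjoint) h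
    rw [Finset.mem_union] at h1
    tauto
  -- `P` projects onto `t`, and `A` interchanges the two sides. With cyclicity of the trace, both
  -- sides contribute equally to the trace of `A ^ 6`.
  have hPA : A * P = (1 - P) * A := by
    ext u v
    simp only [hP, sub_mul, one_mul, Matrix.sub_apply, mul_diagonal, diagonal_mul, hA,
      SimpleGraph.adjMatrix_apply]
    by_cases h : G.Adj u v
    · rcases hG.mem_of_adj h with ⟨h1, h2⟩ | ⟨h1, h2⟩ <;>
      simp only [Finset.mem_coe, hdisj] at h1 h2 <;> simp [h1, h2, h]
    · simp [h]
  have hc : ∀ u v, u ∈ t → v ∉ t → (A ^ 2) u v = 0 := by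
    intro u v hu hv
    rw [adjMatrix_sq_apply, Nat.cast_eq_zero, Finset.card_eq_zero, Finset.eq_empty_iff_forall_notMem]
    intro w hw
    simp only [Finset.mem_inter, SimpleGraph.mem_neighborFinset] at hw
    have a1 := hG.mem_of_adj hw.1
    have a2 := hG.mem_of_adj hw.2
    simp only [Finset.mem_coe, hdisj] at a1 a2
    tauto
  have h1 : (A ^ 6).trace = 2 * (P * A ^ 6).trace := by
    have : ((1 - P) * A ^ 6).trace = (P * A ^ 6).trace := by
      rw [show A ^ 6 = A * A ^ 5 from pow_succ' A 5, ← Matrix.mul_assoc, ← hPA, Matrix.mul_assoc,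
        Matrix.trace_mul_comm, Matrix.mul_assoc, ← pow_succ, ← pow_succ']
    rw [sub_mul, trace_sub, one_mul] at this
    linarith
  have h2 : A ^ 6 = A ^ 2 * A ^ 2 * A ^ 2 := by rw [← pow_add, ← pow_add]
  rw [h1, h2]
  congr 1
  simp only [Matrix.trace, diag_apply, hP, diagonal_mul, ite_mul, one_mul, zero_mul]
  rw [Finset.sum_ite_mem, Finset.univ_inter]
  refine Finset.sum_congr rfl fun u hu => ?_
  simp only [Matrix.mul_apply, Finset.sum_mul]
  rw [Finset.sum_comm, ← Finset.sum_subset (Finset.subset_univ t)]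
  · refine Finset.sum_congr rfl fun v hv => ?_
    rw [← Finset.sum_subset (Finset.subset_univ t)]
    intro w _ hw
    rw [hc v w hv hw]; simp
  · intro v _ hv
    refine Finset.sum_eq_zero fun w _ => ?_
    rw [hc u v hu hv]; simp

/-- A tree in which some vertex is adjacent to a whole side of the bipartition. -/
theorem spectralMoment_six_of_hub {G : SimpleGraph V} [DecidableRel G.Adj] {s t : Finset V}
    (hG : G.IsAcyclic) (hb : G.IsBipartiteWith s t) [DecidableEq V] (hst : s ∪ t = univ) {x : V}
    (hx : ∀ v ∈ t, G.Adj x v) {e : V → ℕ} (he : ∀ v ∈ t, G.degree v = e v + 1) :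
    spectralMoment G 6 = 2 * ((#t : ℝ) ^ 3 + 3 * #t * ∑ v ∈ t, (e v : ℝ) + 3 * ∑ v ∈ t, (e v : ℝ) ^ 2
      + ∑ v ∈ t, (e v : ℝ) ^ 3) := by
  rw [spectralMoment_six hb hst]
  -- On `t` the square of `A` is J + diag(e), with J the all-ones matrix: the hub is the only common
  -- neighbour of two distinct vertices. The rest expands the trace of (J + diag(e))^3.
  have hc : ∀ u ∈ t, ∀ v ∈ t, (G.adjMatrix ℝ ^ 2) u v = 1 + if u = v then (e u : ℝ) else 0 := by
    intro u hu v hv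
    rw [adjMatrix_sq_apply]
    split_ifs with h
    · subst h
      rw [Finset.inter_self, SimpleGraph.card_neighborFinset_eq_degree, he u hu]
      push_cast; ring
    · have h1 := hG.card_inter_neighborFinset_le_one h
      have h2 : 0 < #(G.neighborFinset u ∩ G.neighborFinset v) :=
        Finset.card_pos.2 ⟨x, by simp [(hx u hu).symm, (hx v hv).symm]⟩
      rw [show #(G.neighborFinset u ∩ G.neighborFinset v) = 1 by omega]; simp
  congr 1
  have : ∀ u ∈ t, ∑ v ∈ t, ∑ w ∈ t, (G.adjMatrix ℝ ^ 2) u v *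
      (G.adjMatrix ℝ ^ 2) v w * (G.adjMatrix ℝ ^ 2) w u = (#t : ℝ) ^ 2 + 2 * #t * e u +
        (∑ v ∈ t, (e v : ℝ)) + 3 * (e u : ℝ) ^ 2 + (e u : ℝ) ^ 3 := by
    intro u hu
    have h1 : ∀ v ∈ t, ∑ w ∈ t, (G.adjMatrix ℝ ^ 2) u v *
      (G.adjMatrix ℝ ^ 2) v w * (G.adjMatrix ℝ ^ 2) w u =
        (#t + e v + e u : ℝ) + if u = v then (e u : ℝ) * (#t + 2 * e u) + (e u : ℝ) ^ 2 + (e u : ℝ) ^ 3 else 0 := by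
      intro v hv
      have h2 : ∀ w ∈ t, (G.adjMatrix ℝ ^ 2) u v *
      (G.adjMatrix ℝ ^ 2) v w * (G.adjMatrix ℝ ^ 2) w u =
        (1 + if u = v then (e u : ℝ) else 0) * (1 + (if v = w then (e v : ℝ) else 0) +
          (if u = w then (e u : ℝ) else 0) + if v = w then (if u = v then (e u : ℝ) ^ 2 else 0) else 0) := by
        intro w hw
        rw [hc u hu v hv, hc v hv w hw, hc w hw u hu]
        by_cases h3 : u = v
        · subst h3
          by_cases h4 : u = w
          · subst h4; simp; ring
          · simp [h4, Ne.symm h4]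
        · by_cases h4 : v = w
          · subst h4; simp [h3, Ne.symm h3]
          · by_cases h5 : u = w
            · subst h5; simp [h3, h4]
            · simp [h3, h4, h5, Ne.symm h5]
      rw [Finset.sum_congr rfl h2, ← Finset.mul_sum]
      simp only [Finset.sum_add_distrib, Finset.sum_ite_eq, hu, hv, if_true, Finset.sum_const,
        nsmul_eq_mul]
      by_cases h3 : u = v
      · subst h3; simp; ring
      · simp [h3]
    rw [Finset.sum_congr rfl h1]
    simp only [Finset.sum_add_distrib, Finset.sum_ite_eq, hu, if_true, Finset.sum_const,
        nsmul_eq_mul]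
    ring
  rw [Finset.sum_congr rfl this]
  simp only [Finset.sum_add_distrib, Finset.sum_const, nsmul_eq_mul, ← Finset.mul_sum]
  ring

end Moments

/-! ### Balanced trees, excess sums and comparison by the moments S_4 and S_6. -/

section BalancedTrees

open Finset

/-- `G` is a tree with a bipartition into the classes `s` and `t`, both of size `m + 1`. -/
structure IsBalancedTree {V : Type*} [Fintype V] (m : ℕ) (G : SimpleGraph V) (s t : Finset V) :
    Prop where
  isTree : G.IsTree
  bipartite : G.IsBipartiteWith s t
  mem_or_mem : ∀ v, v ∈ s ∨ v ∈ t
  card_left : #s = m + 1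
  card_right : #t = m + 1

variable {V W : Type*} [Fintype V] [Fintype W] {G : SimpleGraph V} {H : SimpleGraph W}
  {m : ℕ} {s t : Finset V} {s' t' : Finset W}

theorem IsTreeWithBipartition.exists_isBalancedTree (h : IsTreeWithBipartition (m + 1) (m + 1) G) :
    ∃ s t, IsBalancedTree m G s t := by
  classical
  obtain ⟨hG, s, t, hb, hst, hs, ht⟩ := h
  refine ⟨s.toFinset, t.toFinset, hG, by simpa using hb, fun v => ?_, ?_, ?_⟩
  · simpa using hst.ge (Set.mem_univ v)
  · rw [← hs, Set.ncard_eq_toFinset_card']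
  · rw [← ht, Set.ncard_eq_toFinset_card']

namespace IsBalancedTree

theorem symm (h : IsBalancedTree m G s t) : IsBalancedTree m G t s :=
  ⟨h.isTree, h.bipartite.symm, fun v => (h.mem_or_mem v).symm, h.card_right, h.card_left⟩

theorem isTreeWithBipartition (h : IsBalancedTree m G s t) :
    IsTreeWithBipartition (m + 1) (m + 1) G := by
  refine ⟨h.isTree, s, t, h.bipartite, ?_, ?_, ?_⟩
  · ext v; simpa using h.mem_or_mem v
  · simp [h.card_left]
  · simp [h.card_right]

theorem disjoint (h : IsBalancedTree m G s t) : Disjoint s t :=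
  Finset.disjoint_coe.1 h.bipartite.disjoint

theorem union_eq [DecidableEq V] (h : IsBalancedTree m G s t) : s ∪ t = univ := by
  ext v; simpa using h.mem_or_mem v

theorem card_eq (h : IsBalancedTree m G s t) : Fintype.card V = 2 * m + 2 := by
  classical
  rw [← Finset.card_univ, ← h.union_eq, Finset.card_union_of_disjoint h.disjoint, h.card_left,
    h.card_right]
  ring

theorem sum_univ {M : Type*} [AddCommMonoid M] (h : IsBalancedTree m G s t) (f : V → M) :
    ∑ v, f v = ∑ v ∈ s, f v + ∑ v ∈ t, f v := by
  classical
  rw [← h.union_eq, Finset.sum_union h.disjoint]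

theorem spectralMoment_odd (h : IsBalancedTree m G s t) {k : ℕ} (hk : Odd k) :
    spectralMoment G k = 0 := spectralMoment_of_odd h.bipartite.isBipartite hk

variable [DecidableRel G.Adj] [DecidableRel H.Adj]

theorem sum_degree_left (h : IsBalancedTree m G s t) : ∑ v ∈ s, G.degree v = 2 * m + 1 := by
  classical
  rw [SimpleGraph.isBipartiteWith_sum_degrees_eq_card_edges h.bipartite]
  have := h.isTree.card_edgeFinset
  rw [h.card_eq] at this
  omega

theorem degree_pos (h : IsBalancedTree m G s t) (v : V) : 0 < G.degree v := by
  have : Nontrivial V := Fintype.one_lt_card_iff_nontrivial.1 (by rw [h.card_eq]; omega)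
  exact h.isTree.connected.preconnected.degree_pos_of_nontrivial v

/-- The degrees on one side count the 2m + 1 edges, and m + 1 is subtracted. Truncated subtraction
is exact since no degree is zero. -/
theorem sum_excess_left (h : IsBalancedTree m G s t) : ∑ v ∈ s, (G.degree v - 1) = m := by
  have h1 : ∑ v ∈ s, (G.degree v - 1 + 1) = ∑ v ∈ s, G.degree v :=
    Finset.sum_congr rfl fun v _ => Nat.sub_add_cancel (h.degree_pos v)
  rw [Finset.sum_add_distrib, h.sum_degree_left] at h1
  simp [h.card_left] at h1
  omega

theorem sum_degree_sq_left (h : IsBalancedTree m G s t) :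
    ∑ v ∈ s, G.degree v ^ 2 = ∑ v ∈ s, (G.degree v - 1) ^ 2 + 3 * m + 1 := by
  have h1 : ∑ v ∈ s, G.degree v ^ 2 =
      ∑ v ∈ s, ((G.degree v - 1) ^ 2 + 2 * (G.degree v - 1) + 1) :=
    Finset.sum_congr rfl fun v _ => by
      obtain ⟨d, hd⟩ := Nat.exists_eq_succ_of_ne_zero (h.degree_pos v).ne'
      rw [hd, Nat.succ_sub_one, Nat.succ_eq_add_one]; ring
  rw [h1, Finset.sum_add_distrib, Finset.sum_add_distrib, ← Finset.mul_sum, h.sum_excess_left]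
  simp [h.card_left]
  ring

theorem spectralMoment_two (h : IsBalancedTree m G s t) : spectralMoment G 2 = 4 * m + 2 := by
  rw [_root_.spectralMoment_two, h.sum_univ]
  have h1 := h.sum_degree_left
  have h2 := h.symm.sum_degree_left
  rw [← Nat.cast_sum, ← Nat.cast_sum, h1, h2]
  push_cast; ring

theorem spectralMoment_four (h : IsBalancedTree m G s t) : spectralMoment G 4 =
    2 * ((∑ v ∈ s, (G.degree v - 1) ^ 2 + ∑ v ∈ t, (G.degree v - 1) ^ 2 : ℕ) : ℝ) + 8 * m + 2 := by
  rw [_root_.spectralMoment_four h.isTree.isAcyclic, ← _root_.spectralMoment_two,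
    h.spectralMoment_two, h.sum_univ]
  simp only [← Nat.cast_pow, ← Nat.cast_sum]
  rw [h.sum_degree_sq_left, h.symm.sum_degree_sq_left]
  push_cast; ring

theorem spectralMoment_eq_of_lt_four (hG : IsBalancedTree m G s t) (hH : IsBalancedTree m H s' t')
    {i : ℕ} (hi : i < 4) : spectralMoment G i = spectralMoment H i := by
  interval_cases i
  · rw [spectralMoment_zero, spectralMoment_zero, hG.card_eq, hH.card_eq]
  · rw [hG.spectralMoment_odd (by decide), hH.spectralMoment_odd (by decide)]
  · rw [hG.spectralMoment_two, hH.spectralMoment_two]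
  · rw [hG.spectralMoment_odd (by decide), hH.spectralMoment_odd (by decide)]

/-- The tree `G` comes before `H` if it has a smaller sum of squared degrees. -/
theorem sBefore_of_sum_sq_lt (hG : IsBalancedTree m G s t) (hH : IsBalancedTree m H s' t')
    (hm : 2 ≤ m) (h : ∑ v ∈ s, (G.degree v - 1) ^ 2 + ∑ v ∈ t, (G.degree v - 1) ^ 2 <
      ∑ v ∈ s', (H.degree v - 1) ^ 2 + ∑ v ∈ t', (H.degree v - 1) ^ 2) : SBefore G H := by
  -- The index 4 is admissible because there are 2m + 2 > 4 vertices.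
  refine ⟨4, by omega, by rw [hG.card_eq]; omega,
    fun i hi => hG.spectralMoment_eq_of_lt_four hH hi, ?_⟩
  rw [hG.spectralMoment_four, hH.spectralMoment_four]
  have := Nat.cast_lt (α := ℝ).2 h
  linarith

/-- The hub alone uses up the total excess m of its side. -/
theorem degree_eq_one_of_ne_hub (h : IsBalancedTree m G s t) {x : V} (hx : x ∈ s)
    (hdx : G.degree x = m + 1) {v : V} (hv : v ∈ s) (hvx : v ≠ x) : G.degree v = 1 := by
  classical
  have h1 := h.sum_excess_left
  rw [← Finset.add_sum_erase _ _ hx, hdx] at h1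
  have h2 : ∑ v ∈ s.erase x, (G.degree v - 1) = 0 := by omega
  have := Finset.sum_eq_zero_iff.1 h2 v (by simp [hv, hvx])
  have := h.degree_pos v
  omega

theorem adj_hub_iff (h : IsBalancedTree m G s t) {x : V} (hx : x ∈ s)
    (hdx : G.degree x = m + 1) {v : V} : G.Adj x v ↔ v ∈ t := by
  have : G.neighborFinset x = t := by
    refine Finset.eq_of_subset_of_card_le (SimpleGraph.isBipartiteWith_neighborFinset_subset h.bipartite hx) ?_
    rw [h.card_right, SimpleGraph.card_neighborFinset_eq_degree, hdx]
  rw [← this, SimpleGraph.mem_neighborFinset]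

theorem sum_sq_left_of_hub (h : IsBalancedTree m G s t) {x : V} (hx : x ∈ s)
    (hdx : G.degree x = m + 1) : ∑ v ∈ s, (G.degree v - 1) ^ 2 = m ^ 2 := by
  classical
  rw [← Finset.add_sum_erase _ _ hx, hdx, Finset.sum_eq_zero, add_zero, Nat.add_sub_cancel]
  intro v hv
  rw [Finset.mem_erase] at hv
  rw [h.degree_eq_one_of_ne_hub hx hdx hv.2 hv.1]
  simp

/-- If two trees with a full-degree vertex have the same sum of squared degrees, then the one with
the smaller sum of cubes comes first. -/
theorem sBefore_of_hub_of_sum_cube_lt (hG : IsBalancedTree m G s t) (hH : IsBalancedTree m H s' t')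
    (hm : 3 ≤ m) {x : V} (hx : x ∈ s) (hdx : G.degree x = m + 1)
    {x' : W} (hx' : x' ∈ s') (hdx' : H.degree x' = m + 1)
    (h : ∑ v ∈ t, (G.degree v - 1) ^ 2 = ∑ v ∈ t', (H.degree v - 1) ^ 2)
    (h3 : ∑ v ∈ t, (G.degree v - 1) ^ 3 < ∑ v ∈ t', (H.degree v - 1) ^ 3) : SBefore G H := by
  classical
  refine ⟨6, by omega, by rw [hG.card_eq]; omega, fun i hi => ?_, ?_⟩
  · rcases lt_or_ge i 4 with h4 | h4
    · exact hG.spectralMoment_eq_of_lt_four hH h4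
    · interval_cases i
      · rw [hG.spectralMoment_four, hH.spectralMoment_four, h, hG.sum_sq_left_of_hub hx hdx,
          hH.sum_sq_left_of_hub hx' hdx']
      · rw [hG.spectralMoment_odd (by decide), hH.spectralMoment_odd (by decide)]
  · rw [spectralMoment_six_of_hub hG.isTree.isAcyclic hG.bipartite hG.union_eq
        (fun v hv => (hG.adj_hub_iff hx hdx).2 hv) (e := fun v => G.degree v - 1)
        (fun v _ => (Nat.sub_add_cancel (hG.degree_pos v)).symm),
      spectralMoment_six_of_hub hH.isTree.isAcyclic hH.bipartite hH.union_eq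
        (fun v hv => (hH.adj_hub_iff hx' hdx').2 hv) (e := fun v => H.degree v - 1)
        (fun v _ => (Nat.sub_add_cancel (hH.degree_pos v)).symm)]
    -- The linear and quadratic terms of the two sixth moments agree, so the cubes decide.
    have := hG.symm.sum_excess_left.trans hH.symm.sum_excess_left.symm
    rw [hG.card_right, hH.card_right]
    exact_mod_cast by rw [h, this]; omega

end IsBalancedTree

end BalancedTrees

/-! ### Trees with a hub, up to isomorphism. -/

section HubTrees

open Finset

/-- The graph with a centre joined to all elements of `β`, in which every `b : β` carries the
leaves `F b`. -/
def broomGraph {β : Type*} (F : β → Type*) : SimpleGraph (Unit ⊕ β ⊕ Σ b, F b) where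
  Adj
    | .inl _, .inr (.inl _) => True
    | .inr (.inl _), .inl _ => True
    | .inr (.inl b), .inr (.inr y) => y.1 = b
    | .inr (.inr y), .inr (.inl b) => y.1 = b
    | _, _ => False
  symm := ⟨by rintro (_ | _ | _) (_ | _ | _) h <;> simp_all⟩
  loopless := ⟨by rintro (_ | _ | _) <;> simp⟩

theorem broomGraph_iso {β γ : Type*} {F : β → Type*} {F' : γ → Type*} (σ : β ≃ γ)
    (τ : ∀ b, F b ≃ F' (σ b)) : Nonempty (broomGraph F ≃g broomGraph F') := by
  refine ⟨⟨Equiv.sumCongr (Equiv.refl _) (Equiv.sumCongr σ (Equiv.sigmaCongr σ τ)), ?_⟩⟩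
  rintro (_ | _ | ⟨_, _⟩) (_ | _ | ⟨_, _⟩) <;> try simp [broomGraph]
  · exact σ.injective.eq_iff
  · exact σ.injective.eq_iff

variable {V W : Type*} [Fintype V] [Fintype W] {G : SimpleGraph V} {H : SimpleGraph W}
  {m : ℕ} {s t : Finset V} {s' t' : Finset W}

namespace IsBalancedTree

variable [DecidableRel G.Adj] [DecidableRel H.Adj]

/-- Every vertex of `s` other than the hub has degree 1, so it is a leaf attached to exactly one
vertex of `t`. -/
theorem iso_broomGraph (h : IsBalancedTree m G s t) {x : V} (hx : x ∈ s)
    (hdx : G.degree x = m + 1) :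
    Nonempty (broomGraph (fun b : t => {y // G.Adj b y ∧ y ≠ x}) ≃g G) := by
  have hs : ∀ {b y}, b ∈ t → G.Adj b y → y ∈ s := fun hb hy =>
    h.bipartite.symm.mem_of_mem_adj hb hy
  have hst : ∀ {v}, v ∈ s → v ∉ t := fun h1 h2 => Finset.disjoint_left.1 h.disjoint h1 h2
  have huniq : ∀ {y b c}, y ∈ s → y ≠ x → G.Adj b y → G.Adj c y → b = c := by
    intro y b c hy hyx hb hc
    have h1 := (h.degree_eq_one_of_ne_hub hx hdx hy hyx).le
    rw [← SimpleGraph.card_neighborFinset_eq_degree, Finset.card_le_one] at h1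
    exact h1 b (by simpa using hb.symm) c (by simpa using hc.symm)
  have hxb : ∀ {v}, G.Adj x v ↔ v ∈ t := h.adj_hub_iff hx hdx
  let φ : Unit ⊕ t ⊕ (Σ b : t, {y // G.Adj b y ∧ y ≠ x}) → V :=
    Sum.elim (fun _ => x) (Sum.elim (fun b => b) fun y => y.2)
  have hφ : Function.Bijective φ := by
    constructor
    · rintro (_ | ⟨b, hb⟩ | ⟨⟨b, hb⟩, y, hy, hyx⟩) (_ | ⟨c, hc⟩ | ⟨⟨c, hc⟩, z, hz, hzx⟩) hyz <;>
        simp only [φ, Sum.elim_inl, Sum.elim_inr] at hyz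
      · rfl
      · exact absurd (hyz ▸ hc) (hst hx)
      · exact absurd hyz.symm hzx
      · exact absurd (hyz ▸ hb) (hst hx)
      · simp [hyz]
      · exact absurd (hyz ▸ hb) (hst (hs hc hz))
      · exact absurd hyz hyx
      · exact absurd (hyz ▸ hc) (hst (hs hb hy))
      · subst hyz
        obtain rfl := huniq (hs hb hy) hyx hy hz
        rfl
    · intro v
      by_cases hvx : v = x
      · exact ⟨.inl (), hvx.symm⟩
      by_cases hvt : v ∈ t
      · exact ⟨.inr (.inl ⟨v, hvt⟩), rfl⟩
      have hvs := (h.mem_or_mem v).resolve_right hvt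
      obtain ⟨b, hb⟩ := (G.degree_pos_iff_exists_adj v).1 (h.degree_pos v)
      exact ⟨.inr (.inr ⟨⟨b, h.bipartite.mem_of_mem_adj hvs hb⟩, v, hb.symm, hvx⟩), rfl⟩
  refine ⟨⟨Equiv.ofBijective φ hφ, ?_⟩⟩
  have hss : ∀ {v w}, v ∈ s → w ∈ s → ¬ G.Adj v w := fun hv hw hvw =>
    hst hw (h.bipartite.mem_of_mem_adj hv hvw)
  rintro (_ | ⟨b, hb⟩ | ⟨⟨b, hb⟩, y, hy, hyx⟩) (_ | ⟨c, hc⟩ | ⟨⟨c, hc⟩, z, hz, hzx⟩) <;>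
    simp only [φ, Sum.elim_inl, Sum.elim_inr, broomGraph, Equiv.ofBijective_apply, iff_true,
      iff_false]
  · exact G.loopless.1 x
  · exact hxb.2 hc
  · exact hss hx (hs hc hz)
  · exact (hxb.2 hb).symm
  · exact fun hbc => hst (hs hb hbc) hc
  · refine ⟨fun hbz => ?_, fun hcb => ?_⟩
    · rw [Subtype.mk.injEq]; exact huniq (hs hc hz) hzx hz hbz
    · rw [Subtype.mk.injEq] at hcb; exact hcb ▸ hz
  · exact hss (hs hb hy) hx
  · refine ⟨fun hbz => ?_, fun hcb => ?_⟩
    · rw [Subtype.mk.injEq]; exact huniq (hs hb hy) hyx hy hbz.symm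
    · rw [Subtype.mk.injEq] at hcb; exact hcb ▸ hy.symm
  · exact hss (hs hb hy) (hs hc hz)

/-- Trees with a full-degree vertex are determined by the degrees on the opposite side. -/
theorem nonempty_iso_of_hub (hG : IsBalancedTree m G s t) (hH : IsBalancedTree m H s' t') {x : V}
    (hx : x ∈ s) (hdx : G.degree x = m + 1) {x' : W} (hx' : x' ∈ s') (hdx' : H.degree x' = m + 1)
    (σ : t ≃ t') (hσ : ∀ b, H.degree (σ b) = G.degree b) : Nonempty (G ≃g H) := by
  classical
  obtain ⟨φ⟩ := hG.iso_broomGraph hx hdx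
  obtain ⟨ψ⟩ := hH.iso_broomGraph hx' hdx'
  -- One of the neighbours of `b` is the hub, so the leaves at `b` number its excess.
  have hcard : ∀ b : t, Fintype.card {y // G.Adj b y ∧ y ≠ x} = G.degree b - 1 := by
    intro b
    rw [Fintype.card_subtype, ← SimpleGraph.card_neighborFinset_eq_degree,
      ← Finset.card_erase_of_mem (a := x)]
    · congr 1; ext y; simp [and_comm]
    · simpa using ((hG.adj_hub_iff hx hdx).2 b.2).symm
  have hcard' : ∀ b : t', Fintype.card {y // H.Adj b y ∧ y ≠ x'} = H.degree b - 1 := by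
    intro b
    rw [Fintype.card_subtype, ← SimpleGraph.card_neighborFinset_eq_degree,
      ← Finset.card_erase_of_mem (a := x')]
    · congr 1; ext y; simp [and_comm]
    · simpa using ((hH.adj_hub_iff hx' hdx').2 b.2).symm
  obtain ⟨χ⟩ := broomGraph_iso (F := fun b : t => {y // G.Adj b y ∧ y ≠ x})
    (F' := fun b : t' => {y // H.Adj b y ∧ y ≠ x'}) σ
    fun b => Fintype.equivOfCardEq (by rw [hcard, hcard', hσ])
  exact ⟨φ.symm.trans (χ.trans ψ)⟩

end IsBalancedTree

/-! ### Distributions of the total excess over one side. -/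

theorem Fintype.exists_equiv_three {α β : Type*} [Fintype α] [Fintype β]
    (h : Fintype.card α = Fintype.card β) {u v w : α} {u' v' w' : β} (huv : u ≠ v) (huw : u ≠ w)
    (hvw : v ≠ w) (huv' : u' ≠ v') (huw' : u' ≠ w') (hvw' : v' ≠ w') :
    ∃ σ : α ≃ β, σ u = u' ∧ σ v = v' ∧ σ w = w' := by
  classical
  -- A transposition of values corrects a bijection at one point without disturbing points already
  -- placed.
  have key : ∀ (σ : α ≃ β) (a : α) (b : β), ∃ τ : α ≃ β, τ a = b ∧
      ∀ c, σ c ≠ b → c ≠ a → τ c = σ c := fun σ a b =>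
    ⟨σ.trans (Equiv.swap (σ a) b), by simp, fun c h1 h2 => by
      simp [Equiv.swap_apply_of_ne_of_ne (σ.injective.ne h2) h1]⟩
  obtain ⟨σ₁, h1, -⟩ := key (Fintype.equivOfCardEq h) u u'
  obtain ⟨σ₂, h2, h2'⟩ := key σ₁ v v'
  obtain ⟨σ₃, h3, h3'⟩ := key σ₂ w w'
  have e1 : σ₂ u = u' := by rw [h2' u (by rwa [h1]) huv, h1]
  exact ⟨σ₃, by rw [h3' u (by rwa [e1]) huw, e1], by rw [h3' v (by rwa [h2]) hvw, h2], h3⟩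

/-- The excess function `e` is supported on three distinct points of `t`, with the values
`a`, `b`, `c`. -/
def HasProfile {α : Type*} (t : Finset α) (e : α → ℕ) (a b c : ℕ) : Prop :=
  ∃ u ∈ t, ∃ v ∈ t, ∃ w ∈ t, u ≠ v ∧ u ≠ w ∧ v ≠ w ∧ e u = a ∧ e v = b ∧ e w = c ∧
    ∀ z ∈ t, z ≠ u → z ≠ v → z ≠ w → e z = 0

namespace HasProfile

variable {α β : Type*} {T : Finset α} {e : α → ℕ} {a b c : ℕ}

theorem sum_pow (h : HasProfile T e a b c) {n : ℕ} (hn : n ≠ 0) :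
    ∑ v ∈ T, e v ^ n = a ^ n + b ^ n + c ^ n := by
  classical
  obtain ⟨u, hu, v, hv, w, hw, huv, huw, hvw, rfl, rfl, rfl, h0⟩ := h
  rw [← Finset.sum_subset (s₁ := {u, v, w}) (by simp [Finset.insert_subset_iff, *])]
  · rw [Finset.sum_insert (by simp [*]), Finset.sum_pair hvw, add_assoc]
  · intro z hz hz'
    simp only [Finset.mem_insert, Finset.mem_singleton, not_or] at hz'
    rw [h0 z hz hz'.1 hz'.2.1 hz'.2.2, zero_pow hn]

/-- Needed for m = 3, where the profiles (1, 2, 0) and (2, 1, 0) must be matched. -/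
theorem swap (h : HasProfile T e a b c) : HasProfile T e b a c := by
  obtain ⟨u, hu, v, hv, w, hw, huv, huw, hvw, rfl, rfl, rfl, h0⟩ := h
  exact ⟨v, hv, u, hu, w, hw, huv.symm, hvw, huw, rfl, rfl, rfl,
    fun z hz h1 h2 h3 => h0 z hz h2 h1 h3⟩

theorem exists_equiv (h : HasProfile T e a b c) {T' : Finset β} {e' : β → ℕ}
    (h' : HasProfile T' e' a b c) (hT : #T = #T') : ∃ σ : T ≃ T', ∀ z, e' (σ z) = e z := by
  obtain ⟨u, hu, v, hv, w, hw, huv, huw, hvw, rfl, rfl, rfl, h0⟩ := h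
  obtain ⟨u', hu', v', hv', w', hw', huv', huw', hvw', h1, h2, h3, h0'⟩ := h'
  obtain ⟨σ, hσu, hσv, hσw⟩ := Fintype.exists_equiv_three (α := T) (β := T') (by simpa using hT)
    (u := ⟨u, hu⟩) (v := ⟨v, hv⟩) (w := ⟨w, hw⟩) (u' := ⟨u', hu'⟩) (v' := ⟨v', hv'⟩)
    (w' := ⟨w', hw'⟩) (by simpa) (by simpa) (by simpa) (by simpa) (by simpa) (by simpa)
  refine ⟨σ, fun z => ?_⟩
  by_cases hzu : z = ⟨u, hu⟩
  · rw [hzu, hσu]; exact h1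
  by_cases hzv : z = ⟨v, hv⟩
  · rw [hzv, hσv]; exact h2
  by_cases hzw : z = ⟨w, hw⟩
  · rw [hzw, hσw]; exact h3
  rw [h0 z z.2 (by simpa [Subtype.ext_iff] using hzu) (by simpa [Subtype.ext_iff] using hzv)
    (by simpa [Subtype.ext_iff] using hzw)]
  refine h0' _ (σ z).2 ?_ ?_ ?_
  · intro hz; exact hzu (σ.injective (by rw [hσu]; exact Subtype.ext hz))
  · intro hz; exact hzv (σ.injective (by rw [hσv]; exact Subtype.ext hz))
  · intro hz; exact hzw (σ.injective (by rw [hσw]; exact Subtype.ext hz))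

end HasProfile

theorem IsBalancedTree.nonempty_iso_of_hasProfile [DecidableRel G.Adj] [DecidableRel H.Adj]
    (hG : IsBalancedTree m G s t) (hH : IsBalancedTree m H s' t') {x : V}
    (hx : x ∈ s) (hdx : G.degree x = m + 1) {x' : W} (hx' : x' ∈ s') (hdx' : H.degree x' = m + 1)
    {a b c : ℕ} (h : HasProfile t (fun v => G.degree v - 1) a b c)
    (h' : HasProfile t' (fun v => H.degree v - 1) a b c) : Nonempty (G ≃g H) := by
  obtain ⟨σ, hσ⟩ := h.exists_equiv h' (hG.card_right.trans hH.card_right.symm)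
  refine hG.nonempty_iso_of_hub hH hx hdx hx' hdx' σ fun b => ?_
  have h1 := hσ b
  have h2 := hG.degree_pos b
  have h3 := hH.degree_pos (σ b)
  omega

/-- Here `a` is the largest excess and m = a + n + 3. The first hypothesis rearranges to (n+1)^2 + 2
≤ a(1-n), forcing n = 0 and a ≥ 3; the second to (a-2)(n+1) ≤ 1, forcing a ≤ 3. -/
theorem eq_three_of_sq_add_le {a n : ℕ} (h2 : (a + n + 1) ^ 2 + 2 ≤ a * (a + 2 + n + 1))
    (h1 : (a + n + 1) ^ 2 + 2 ≤ a ^ 2 + (n + 3) ^ 2) : a = 3 ∧ n = 0 := by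
  have h3 : a ≤ 3 := by
    by_contra h4
    obtain ⟨k, rfl⟩ : ∃ k, a = k + 4 := ⟨a - 4, by omega⟩
    nlinarith
  have h4 : n ≤ 1 := by
    by_contra h5
    obtain ⟨k, rfl⟩ : ∃ k, n = k + 2 := ⟨n - 2, by omega⟩
    nlinarith
  interval_cases a <;> interval_cases n <;> simp_all

/-- Either almost all of the excess sits at one point, or the sum of squares is small. -/
theorem hasProfile_or_sum_sq_le {α : Type*} {T : Finset α} {e : α → ℕ} (hm : 3 ≤ m)
    (hT : #T = m + 1) (he : ∑ v ∈ T, e v = m) :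
    HasProfile T e m 0 0 ∨ HasProfile T e (m - 1) 1 0 ∨ HasProfile T e (m - 2) 2 0 ∨
    HasProfile T e (m - 2) 1 1 ∨ (∑ v ∈ T, e v ^ 2 < (m - 2) ^ 2 + 2) ∨
    (m = 6 ∧ ∑ v ∈ T, e v ^ 2 = (m - 2) ^ 2 + 2 ∧ ∑ v ∈ T, e v ^ 3 ≤ 54) := by
  classical
  -- Take `u`, `v`, `w` with the three largest excesses, in decreasing order.
  obtain ⟨u, hu, hmax⟩ := T.exists_max_image e (Finset.card_pos.1 (by omega))
  have hc1 : #(T.erase u) = m := by rw [Finset.card_erase_of_mem hu, hT]; rfl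
  obtain ⟨v, hv, hmaxv⟩ := (T.erase u).exists_max_image e (Finset.card_pos.1 (by omega))
  have hc2 : #((T.erase u).erase v) = m - 1 := by rw [Finset.card_erase_of_mem hv, hc1]
  obtain ⟨w, hw, hmaxw⟩ := ((T.erase u).erase v).exists_max_image e (Finset.card_pos.1 (by omega))
  set R := ((T.erase u).erase v).erase w with hR
  have s1 : e u + ∑ z ∈ T.erase u, e z = m := by rw [Finset.add_sum_erase _ _ hu, he]
  have s2 : e v + ∑ z ∈ (T.erase u).erase v, e z = ∑ z ∈ T.erase u, e z :=
    Finset.add_sum_erase _ _ hv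
  have s3 : e w + ∑ z ∈ R, e z = ∑ z ∈ (T.erase u).erase v, e z := Finset.add_sum_erase _ _ hw
  have z2 : e v = 0 → ∑ z ∈ T.erase u, e z = 0 := fun h0 =>
    Finset.sum_eq_zero fun z hz => by have := hmaxv z hz; omega
  have z3 : e w = 0 → ∑ z ∈ (T.erase u).erase v, e z = 0 := fun h0 =>
    Finset.sum_eq_zero fun z hz => by have := hmaxw z hz; omega
  have prof : ∀ a b c, e u = a → e v = b → e w = c → a + b + c = m → HasProfile T e a b c := by
    intro a b c ha hb hc habc
    simp only [Finset.mem_erase] at hv hw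
    refine ⟨u, hu, v, hv.2, w, hw.2.2, hv.1.symm, hw.2.1.symm, hw.1.symm, ha, hb, hc, ?_⟩
    intro z hz h1 h2 h3
    exact Finset.sum_eq_zero_iff.1 (show ∑ z ∈ R, e z = 0 by omega) z (by simp [*])
  by_cases hu3 : e u + 2 < m
  · right; right; right; right
    have q1 : ∑ z ∈ T, e z ^ 2 = e u ^ 2 + ∑ z ∈ T.erase u, e z ^ 2 :=
      (Finset.add_sum_erase T (fun z => e z ^ 2) hu).symm
    have q2 : ∑ z ∈ T, e z ^ 2 ≤ e u * m := by
      rw [← he, Finset.mul_sum]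
      exact Finset.sum_le_sum fun z hz => by rw [pow_two]; exact Nat.mul_le_mul_right _ (hmax z hz)
    have q3 : ∑ z ∈ T, e z ^ 2 ≤ e u ^ 2 + (m - e u) ^ 2 := by
      rw [q1, show m - e u = ∑ z ∈ T.erase u, e z by omega, Nat.add_le_add_iff_left]
      exact Finset.sum_sq_le_sq_sum_of_nonneg fun _ _ => Nat.zero_le _
    have q4 : ∑ z ∈ T, e z ^ 3 ≤ e u * ∑ z ∈ T, e z ^ 2 := by
      rw [Finset.mul_sum]
      exact Finset.sum_le_sum fun z hz => by
        rw [pow_succ' (e z) 2]; exact Nat.mul_le_mul_right _ (hmax z hz)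
    obtain ⟨n, rfl⟩ := Nat.exists_eq_add_of_lt hu3
    rw [show e u + 2 + n + 1 - 2 = e u + n + 1 by omega]
    rw [show e u + 2 + n + 1 - e u = n + 3 by omega] at q3
    by_cases hlt : ∑ z ∈ T, e z ^ 2 < (e u + n + 1) ^ 2 + 2
    · exact .inl hlt
    -- Only maximum 3 with m = 6 survives; then `q2` bounds the squares by 18 and `q4` the cubes by
    -- 54.
    · obtain ⟨ha, rfl⟩ := eq_three_of_sq_add_le ((not_lt.1 hlt).trans q2) ((not_lt.1 hlt).trans q3)
      rw [ha] at q2 q4 hlt ⊢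
      omega
  · have : e u = m ∨ e u = m - 1 ∨ e u = m - 2 := by omega
    rcases this with h | h | h
    · exact .inl (prof _ _ _ h (by omega) (by omega) (by omega))
    · have hv1 : e v = 1 := by
        have : e v ≠ 0 := fun h0 => by have := z2 h0; omega
        omega
      exact .inr (.inl (prof _ _ _ h hv1 (by omega) (by omega)))
    · have hv1 : e v ≠ 0 := fun h0 => by have := z2 h0; omega
      by_cases hv2 : e v = 2
      · exact .inr (.inr (.inl (prof _ _ _ h hv2 (by omega) (by omega))))
      · have : e w ≠ 0 := fun h0 => by have := z3 h0; omega
        exact .inr (.inr (.inr (.inl (prof _ _ _ h (by omega) (by omega) (by omega)))))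

/-- If the largest excess is a, the squares sum to at most a^2 + (m-a)^2, which by convexity is
greatest on 1 ≤ a ≤ m-1 at the ends. -/
theorem sum_sq_le_of_forall_lt {α : Type*} {T : Finset α} {e : α → ℕ}
    (he : ∑ v ∈ T, e v = m) (h : ∀ v ∈ T, e v < m) :
    ∑ v ∈ T, e v ^ 2 ≤ (m - 1) ^ 2 + 1 := by
  classical
  rcases T.eq_empty_or_nonempty with rfl | hT
  · simp
  obtain ⟨u, hu, hmax⟩ := T.exists_max_image e hT
  have q1 : ∑ z ∈ T, e z ^ 2 = e u ^ 2 + ∑ z ∈ T.erase u, e z ^ 2 :=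
    (Finset.add_sum_erase T (fun z => e z ^ 2) hu).symm
  have s1 : e u + ∑ z ∈ T.erase u, e z = m := by rw [Finset.add_sum_erase _ _ hu, he]
  have hum := h u hu
  have q3 : ∑ z ∈ T, e z ^ 2 ≤ e u ^ 2 + (m - e u) ^ 2 := by
    rw [q1, show m - e u = ∑ z ∈ T.erase u, e z by omega, Nat.add_le_add_iff_left]
    exact Finset.sum_sq_le_sq_sum_of_nonneg fun _ _ => Nat.zero_le _
  have h0 : e u ≠ 0 := by
    intro h0
    have : ∑ z ∈ T, e z = 0 := Finset.sum_eq_zero fun z hz => by have := hmax z hz; omega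
    omega
  refine q3.trans ?_
  obtain ⟨a, ha⟩ := Nat.exists_eq_succ_of_ne_zero h0
  obtain ⟨b, rfl⟩ := Nat.exists_eq_add_of_lt hum
  rw [ha, Nat.succ_eq_add_one, show a + 1 + b + 1 - (a + 1) = b + 1 by omega,
    show a + 1 + b + 1 - 1 = a + b + 1 by omega]
  -- The difference of the two sides is exactly 2ab.
  nlinarith [Nat.zero_le (a * b)]

end HubTrees

/-! ### The trees B^{k,l} and their excesses. -/

section TreeB

open Finset

theorem treeB_adj_inl_inr {p q k l : ℕ} (i : Fin p) (j : Fin q) :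
    (treeB p q k l).Adj (.inl i) (.inr j) ↔ (i : ℕ) = 0 ∨ (j : ℕ) = treeBAttach k l i := by
  simp [treeB]

theorem treeB_not_adj_inl_inl {p q k l : ℕ} (i j : Fin p) :
    ¬ (treeB p q k l).Adj (.inl i) (.inl j) := by
  simp [treeB]

theorem treeB_not_adj_inr_inr {p q k l : ℕ} (i j : Fin q) :
    ¬ (treeB p q k l).Adj (.inr i) (.inr j) := by
  simp [treeB]

variable {m k l : ℕ}

theorem treeB_isBipartiteWith {p q : ℕ} : (treeB p q k l).IsBipartiteWith
    (univ.map Function.Embedding.inl : Finset (Fin p ⊕ Fin q))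
    (univ.map Function.Embedding.inr : Finset (Fin p ⊕ Fin q)) := by
  refine ⟨?_, ?_⟩
  · rw [Finset.disjoint_coe, Finset.disjoint_left]; rintro (_ | _) <;> simp
  · rintro (i | i) (j | j) h
    · exact absurd h (treeB_not_adj_inl_inl i j)
    · simp
    · simp
    · exact absurd h (treeB_not_adj_inr_inr i j)

theorem treeBAttach_lt (h : l + 1 ≤ m) (i : ℕ) : treeBAttach k l i < m + 1 := by
  unfold treeBAttach; split_ifs <;> omega

theorem treeB_degree_inr [DecidableRel (treeB (m + 1) (m + 1) k l).Adj] (j : Fin (m + 1)) :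
    (treeB (m + 1) (m + 1) k l).degree (.inr j) =
      #{i ∈ Finset.range m | treeBAttach k l (i + 1) = j} + 1 := by
  have h : (treeB (m + 1) (m + 1) k l).neighborFinset (.inr j) =
      ({i : Fin (m + 1) | (i : ℕ) = 0 ∨ (j : ℕ) = treeBAttach k l i} : Finset _).map
        Function.Embedding.inl := by
    ext (i | i)
    · simp [SimpleGraph.adj_comm _ (Sum.inr j), treeB_adj_inl_inr]
    · simp [treeB_not_adj_inr_inr]
  rw [← SimpleGraph.card_neighborFinset_eq_degree, h, Finset.card_map, Fin.card_filter_univ_succ]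
  simp only [Fin.val_zero, true_or, if_true, Fin.val_succ, Nat.succ_ne_zero, false_or,
    Nat.add_left_inj]
  rw [Finset.card_filter, Finset.card_filter, Finset.sum_range]
  simp only [eq_comm]

theorem isBalancedTree_treeB (h : l + 1 ≤ m) :
    IsBalancedTree m (treeB (m + 1) (m + 1) k l) (univ.map Function.Embedding.inl)
      (univ.map Function.Embedding.inr) := by
  classical
  refine ⟨SimpleGraph.isTree_iff_connected_and_card.2 ⟨?_, ?_⟩, treeB_isBipartiteWith,
    by rintro (_ | _) <;> simp, by simp, by simp⟩
  · have h1 : ∀ j, (treeB (m + 1) (m + 1) k l).Reachable (.inl 0) (.inr j) := fun j =>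
      SimpleGraph.Adj.reachable ((treeB_adj_inl_inr _ _).2 (.inl rfl))
    refine SimpleGraph.connected_iff_exists_forall_reachable _ |>.2 ⟨.inl 0, ?_⟩
    rintro (i | j)
    · exact (h1 ⟨_, treeBAttach_lt (k := k) h i⟩).trans
        (SimpleGraph.Adj.reachable ((treeB_adj_inl_inr _ _).2 (.inr rfl)).symm)
    · exact h1 j
  · rw [Nat.card_eq_fintype_card, ← SimpleGraph.edgeFinset_card,
      ← SimpleGraph.isBipartiteWith_sum_degrees_eq_card_edges' treeB_isBipartiteWith,
      Finset.sum_map]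
    change ∑ j, (treeB (m + 1) (m + 1) k l).degree (.inr j) + 1 = _
    simp only [treeB_degree_inr, Finset.sum_add_distrib]
    -- Edges are counted from the black side: the hub gives m + 1, and the fibres of the attachment
    -- map partition the m other white vertices.
    have := Finset.card_eq_sum_card_fiberwise (s := Finset.range m) (t := Finset.range (m + 1))
      (f := fun i => treeBAttach k l (i + 1)) fun i _ => by simpa using treeBAttach_lt h (i + 1)
    rw [Finset.sum_range] at this
    rw [← this]
    simp
    omega

theorem treeB_degree_hub [DecidableRel (treeB (m + 1) (m + 1) k l).Adj] :
    (treeB (m + 1) (m + 1) k l).degree (.inl 0) = m + 1 := by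
  have h : (treeB (m + 1) (m + 1) k l).neighborFinset (.inl 0) =
      univ.map Function.Embedding.inr := by
    ext (i | i)
    · simp [treeB_not_adj_inl_inl]
    · simp [treeB_adj_inl_inr]
  rw [← SimpleGraph.card_neighborFinset_eq_degree, h]
  simp

theorem card_treeBAttach_eq (h : k + l ≤ m) (j : ℕ) :
    #{i ∈ Finset.range m | treeBAttach k l (i + 1) = j} =
      if j = 0 then m - k - l else if j = 1 then k else if j ≤ l + 1 then 1 else 0 := by
  split_ifs with h0 h1 h2
  · rw [show m - k - l = #(Finset.Ico (k + l) m) by simp; omega]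
    congr 1; ext i
    rw [Finset.mem_filter]
    simp only [Finset.mem_range, Finset.mem_Ico, treeBAttach]
    split_ifs <;> omega
  · rw [← Finset.card_range k]
    congr 1; ext i
    rw [Finset.mem_filter]
    simp only [Finset.mem_range, Finset.card_range, treeBAttach]
    split_ifs <;> omega
  · rw [Finset.card_eq_one]
    -- White vertex i + 1 hangs on black vertex (i + 1) - k + 1, which equals `j` for this i.
    refine ⟨k + j - 2, ?_⟩
    ext i
    rw [Finset.mem_filter]
    simp only [Finset.mem_range, Finset.mem_singleton, treeBAttach]
    split_ifs <;> omega
  · rw [Finset.card_eq_zero]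
    ext i
    rw [Finset.mem_filter]
    simp only [Finset.mem_range, treeBAttach, Finset.notMem_empty, iff_false]
    split_ifs <;> omega

theorem treeB_excess_inr [DecidableRel (treeB (m + 1) (m + 1) k l).Adj] (h : k + l ≤ m)
    (j : Fin (m + 1)) : (treeB (m + 1) (m + 1) k l).degree (.inr j) - 1 =
      if (j : ℕ) = 0 then m - k - l else if (j : ℕ) = 1 then k else if (j : ℕ) ≤ l + 1 then 1
      else 0 := by
  rw [treeB_degree_inr, card_treeBAttach_eq h, Nat.add_sub_cancel]

theorem treeB_hasProfile_zero [DecidableRel (treeB (m + 1) (m + 1) k 0).Adj] (hm : 2 ≤ m)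
    (hk : k + 0 ≤ m) : HasProfile (univ.map Function.Embedding.inr)
      (fun v => (treeB (m + 1) (m + 1) k 0).degree v - 1) (m - k) k 0 := by
  refine ⟨.inr ⟨0, by omega⟩, by simp, .inr ⟨1, by omega⟩, by simp, .inr ⟨2, by omega⟩, by simp,
    by simp, by simp, by simp, ?_, ?_, ?_, ?_⟩
  · simp only [treeB_excess_inr hk]; simp
  · simp only [treeB_excess_inr hk]; simp
  · simp only [treeB_excess_inr hk]; simp
  · rintro (j | j) hj h0 h1 h2
    · simp at hj
    · simp only [ne_eq, Sum.inr.injEq, Fin.ext_iff] at h0 h1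
      simp only [treeB_excess_inr hk]
      split_ifs <;> omega

theorem treeB_hasProfile_one [DecidableRel (treeB (m + 1) (m + 1) 0 1).Adj] (hm : 2 ≤ m) :
    HasProfile (univ.map Function.Embedding.inr)
      (fun v => (treeB (m + 1) (m + 1) 0 1).degree v - 1) (m - 1) 1 0 := by
  have hk : 0 + 1 ≤ m := by omega
  -- With k = 0 black vertex 1 carries no leaf; the single extra leaf hangs on black vertex 2.
  refine ⟨.inr ⟨0, by omega⟩, by simp, .inr ⟨2, by omega⟩, by simp, .inr ⟨1, by omega⟩, by simp,
    by simp, by simp, by simp, ?_, ?_, ?_, ?_⟩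
  · simp only [treeB_excess_inr hk]; simp
  · simp only [treeB_excess_inr hk]; simp
  · simp only [treeB_excess_inr hk]; simp
  · rintro (j | j) hj h0 h1 h2
    · simp at hj
    · simp only [ne_eq, Sum.inr.injEq, Fin.ext_iff] at h0 h1 h2
      simp only [treeB_excess_inr hk]
      split_ifs <;> omega

theorem treeB_hasProfile_two [DecidableRel (treeB (m + 1) (m + 1) 0 2).Adj] (hm : 3 ≤ m) :
    HasProfile (univ.map Function.Embedding.inr)
      (fun v => (treeB (m + 1) (m + 1) 0 2).degree v - 1) (m - 2) 1 1 := by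
  have hk : 0 + 2 ≤ m := by omega
  refine ⟨.inr ⟨0, by omega⟩, by simp, .inr ⟨2, by omega⟩, by simp, .inr ⟨3, by omega⟩, by simp,
    by simp, by simp, by simp, ?_, ?_, ?_, ?_⟩
  · simp only [treeB_excess_inr hk]; simp
  · simp only [treeB_excess_inr hk]; simp
  · simp only [treeB_excess_inr hk]; simp
  · rintro (j | j) hj h0 h1 h2
    · simp at hj
    · simp only [ne_eq, Sum.inr.injEq, Fin.ext_iff] at h0 h1 h2
      simp only [treeB_excess_inr hk]
      split_ifs <;> omega

theorem treeB_sum_sq [DecidableRel (treeB (m + 1) (m + 1) k l).Adj] (hl : l + 1 ≤ m) {a b c : ℕ}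
    (h : HasProfile (univ.map Function.Embedding.inr)
      (fun v => (treeB (m + 1) (m + 1) k l).degree v - 1) a b c) :
    ∑ v ∈ univ.map Function.Embedding.inl, ((treeB (m + 1) (m + 1) k l).degree v - 1) ^ 2 +
      ∑ v ∈ univ.map Function.Embedding.inr, ((treeB (m + 1) (m + 1) k l).degree v - 1) ^ 2 =
      m ^ 2 + (a ^ 2 + b ^ 2 + c ^ 2) := by
  rw [(isBalancedTree_treeB hl).sum_sq_left_of_hub (x := .inl 0) (by simp) treeB_degree_hub,
    h.sum_pow two_ne_zero]

theorem treeB_sBefore {k' l' a b c a' b' c' : ℕ} [DecidableRel (treeB (m + 1) (m + 1) k l).Adj]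
    [DecidableRel (treeB (m + 1) (m + 1) k' l').Adj] (hm : 2 ≤ m)
    (hl : l + 1 ≤ m) (hl' : l' + 1 ≤ m)
    (h : HasProfile (univ.map Function.Embedding.inr)
      (fun v => (treeB (m + 1) (m + 1) k l).degree v - 1) a b c)
    (h' : HasProfile (univ.map Function.Embedding.inr)
      (fun v => (treeB (m + 1) (m + 1) k' l').degree v - 1) a' b' c')
    (hlt : a ^ 2 + b ^ 2 + c ^ 2 < a' ^ 2 + b' ^ 2 + c' ^ 2) :
    SBefore (treeB (m + 1) (m + 1) k l) (treeB (m + 1) (m + 1) k' l') := by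
  refine (isBalancedTree_treeB hl).sBefore_of_sum_sq_lt (isBalancedTree_treeB hl') hm ?_
  rw [treeB_sum_sq hl h, treeB_sum_sq hl' h']
  omega

/-- The smaller of the two deciding indices decides between `F` and `H`. -/
theorem SBefore.trans {U V W : Type*} [Fintype U] [Fintype V] [Fintype W] {F : SimpleGraph U}
    {G : SimpleGraph V} {H : SimpleGraph W} (h1 : SBefore F G) (h2 : SBefore G H) :
    SBefore F H := by
  obtain ⟨i, hi, hiU, hieq, hilt⟩ := h1
  obtain ⟨j, hj, hjV, hjeq, hjlt⟩ := h2
  refine ⟨min i j, by omega, by omega, fun n hn => ?_, ?_⟩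
  · rw [hieq n (by omega), hjeq n (by omega)]
  · rcases lt_trichotomy i j with h | rfl | h
    · rw [min_eq_left h.le, ← hjeq i h]; exact hilt
    · rw [min_self]; exact hilt.trans hjlt
    · rw [min_eq_right h.le, hieq j h]; exact hjlt

/-! ### Classification of all balanced trees against B^{0,2}. -/

section Classification

variable {V : Type*} [Fintype V] {G : SimpleGraph V} {s t : Finset V}

theorem IsBalancedTree.nonempty_iso_or_sBefore_of_hub [DecidableRel G.Adj]
    (hG : IsBalancedTree m G s t) (hm : 3 ≤ m) {x : V} (hx : x ∈ s) (hdx : G.degree x = m + 1) :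
    Nonempty (G ≃g treeB (m + 1) (m + 1) 0 0) ∨ Nonempty (G ≃g treeB (m + 1) (m + 1) 0 1) ∨
    Nonempty (G ≃g treeB (m + 1) (m + 1) 2 0) ∨ Nonempty (G ≃g treeB (m + 1) (m + 1) 0 2) ∨
    SBefore G (treeB (m + 1) (m + 1) 0 2) := by
  classical
  have hB : ∀ {k l : ℕ}, l + 1 ≤ m → ∀ {a b c : ℕ}, HasProfile t (fun v => G.degree v - 1) a b c →
      HasProfile (univ.map Function.Embedding.inr)
        (fun v => (treeB (m + 1) (m + 1) k l).degree v - 1) a b c →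
      Nonempty (G ≃g treeB (m + 1) (m + 1) k l) := fun hl _ _ _ h h' =>
    hG.nonempty_iso_of_hasProfile (isBalancedTree_treeB hl) hx hdx (x' := .inl 0) (by simp)
      treeB_degree_hub h h'
  have h2 := treeB_hasProfile_two hm
  have hT := isBalancedTree_treeB (m := m) (k := 0) (l := 2) (by omega)
  rcases hasProfile_or_sum_sq_le hm hG.card_right hG.symm.sum_excess_left with
    h | h | h | h | h | ⟨h6, h, h3⟩
  · exact .inl (hB (by omega) h (treeB_hasProfile_zero (by omega) (by omega)))
  · exact .inr (.inl (hB (by omega) h (treeB_hasProfile_one (by omega))))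
  · exact .inr (.inr (.inl (hB (by omega) h (treeB_hasProfile_zero (by omega) (by omega)))))
  · exact .inr (.inr (.inr (.inl (hB (by omega) h h2))))
  · refine .inr (.inr (.inr (.inr (hG.sBefore_of_sum_sq_lt hT (by omega) ?_))))
    rw [treeB_sum_sq (by omega) h2, hG.sum_sq_left_of_hub hx hdx]
    omega
  -- The tie at m = 6: cubes at most 54 against 4^3 + 1 + 1 = 66.
  · refine .inr (.inr (.inr (.inr (hG.sBefore_of_hub_of_sum_cube_lt hT hm hx hdx (x' := .inl 0)
      (by simp) treeB_degree_hub ?_ ?_))))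
    · rw [h, h2.sum_pow two_ne_zero]
      ring
    · rw [h2.sum_pow three_ne_zero, h6]
      omega

theorem IsBalancedTree.nonempty_iso_or_sBefore (hG : IsBalancedTree m G s t) (hm : 3 ≤ m) :
    Nonempty (G ≃g treeB (m + 1) (m + 1) 0 0) ∨ Nonempty (G ≃g treeB (m + 1) (m + 1) 0 1) ∨
    Nonempty (G ≃g treeB (m + 1) (m + 1) 2 0) ∨ Nonempty (G ≃g treeB (m + 1) (m + 1) 0 2) ∨
    SBefore G (treeB (m + 1) (m + 1) 0 2) := by
  classical
  by_cases h1 : ∃ x ∈ s, G.degree x = m + 1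
  · obtain ⟨x, hx, hdx⟩ := h1
    exact hG.nonempty_iso_or_sBefore_of_hub hm hx hdx
  by_cases h2 : ∃ x ∈ t, G.degree x = m + 1
  · obtain ⟨x, hx, hdx⟩ := h2
    exact hG.symm.nonempty_iso_or_sBefore_of_hub hm hx hdx
  -- No hub on either side: every excess is below m, and the two side bounds together fall short by
  -- 2.
  push Not at h1 h2
  refine .inr (.inr (.inr (.inr (hG.sBefore_of_sum_sq_lt
    (isBalancedTree_treeB (m := m) (k := 0) (l := 2) (by omega)) (by omega) ?_))))
  rw [treeB_sum_sq (by omega) (treeB_hasProfile_two hm)]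
  have b1 := sum_sq_le_of_forall_lt hG.sum_excess_left fun v hv => by
    have := SimpleGraph.isBipartiteWith_degree_le hG.bipartite hv
    rw [hG.card_right] at this
    have := h1 v hv
    omega
  have b2 := sum_sq_le_of_forall_lt hG.symm.sum_excess_left fun v hv => by
    have := SimpleGraph.isBipartiteWith_degree_le hG.symm.bipartite hv
    rw [hG.card_left] at this
    have := h2 v hv
    omega
  refine (Nat.add_le_add b1 b2).trans_lt ?_
  obtain ⟨n, rfl⟩ := Nat.exists_eq_add_of_le hm
  rw [show 3 + n - 1 = n + 2 by omega, show 3 + n - 2 = n + 1 by omega]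
  nlinarith

end Classification

end TreeB

/-! ### The last trees in the S-order. -/

theorem theorem3p2 (p q : ℕ) (hp : 4 ≤ p) (hpq : p = q) :
    (5 ≤ p → AreLastTrees.{u} p q [treeB p q 0 2, treeB p q 2 0, treeB p q 0 1, treeB p q 0 0]) ∧
    (p = 4 → Nonempty (treeB p q 2 0 ≃g treeB p q 0 1) ∧
      AreLastTrees.{u} p q [treeB p q 0 2, treeB p q 0 1, treeB p q 0 0]) := by
  classical
  subst hpq
  obtain ⟨m, rfl⟩ : ∃ m, p = m + 1 := ⟨p - 1, by omega⟩
  have hm : 3 ≤ m := by omega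
  have p00 := treeB_hasProfile_zero (m := m) (k := 0) (by omega) (by omega)
  have p20 := treeB_hasProfile_zero (m := m) (k := 2) (by omega) (by omega)
  have p01 := treeB_hasProfile_one (m := m) (by omega)
  have p02 := treeB_hasProfile_two hm
  have b02_20 : SBefore (treeB (m + 1) (m + 1) 0 2) (treeB (m + 1) (m + 1) 2 0) :=
    treeB_sBefore (by omega) (by omega) (by omega) p02 p20 (by omega)
  -- The square sums differ by 2m - 6, which vanishes at m = 3.
  have b20_01 (h4 : 4 ≤ m) : SBefore (treeB (m + 1) (m + 1) 2 0) (treeB (m + 1) (m + 1) 0 1) := by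
    refine treeB_sBefore (by omega) (by omega) (by omega) p20 p01 ?_
    obtain ⟨n, rfl⟩ := Nat.exists_eq_add_of_le h4
    rw [show 4 + n - 1 = n + 3 by omega, show 4 + n - 2 = n + 2 by omega]
    nlinarith
  have b01_00 : SBefore (treeB (m + 1) (m + 1) 0 1) (treeB (m + 1) (m + 1) 0 0) := by
    refine treeB_sBefore (by omega) (by omega) (by omega) p01 p00 ?_
    obtain ⟨n, rfl⟩ := Nat.exists_eq_add_of_le hm
    rw [show 3 + n - 1 = n + 2 by omega, Nat.sub_zero]
    nlinarith
  -- Proved directly, since the chain through B^{2,0} is not available for m = 3.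
  have b02_01 : SBefore (treeB (m + 1) (m + 1) 0 2) (treeB (m + 1) (m + 1) 0 1) := by
    refine treeB_sBefore (by omega) (by omega) (by omega) p02 p01 ?_
    obtain ⟨n, rfl⟩ := Nat.exists_eq_add_of_le hm
    rw [show 3 + n - 1 = n + 2 by omega, show 3 + n - 2 = n + 1 by omega]
    nlinarith
  have hT : ∀ k l, l + 1 ≤ m → IsTreeWithBipartition (m + 1) (m + 1) (treeB (m + 1) (m + 1) k l) :=
    fun k l hl => (isBalancedTree_treeB hl).isTreeWithBipartition
  refine ⟨fun h5 => ⟨?_, ?_, ?_⟩, fun h4 => ?_⟩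
  · simp only [List.mem_cons, List.not_mem_nil, or_false]
    rintro G (rfl | rfl | rfl | rfl) <;> exact hT _ _ (by omega)
  · have b1 := b20_01 (by omega)
    simp [b02_20, b02_01, b02_01.trans b01_00, b1, b1.trans b01_00, b01_00]
  · intro V _ T hTT hiso
    simp only [List.mem_cons, List.not_mem_nil, or_false, forall_eq_or_imp, forall_eq] at hiso ⊢
    obtain ⟨s, t, hst⟩ := hTT.exists_isBalancedTree
    rcases hst.nonempty_iso_or_sBefore hm with h | h | h | h | h
    · exact absurd h hiso.2.2.2
    · exact absurd h hiso.2.2.1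
    · exact absurd h hiso.2.1
    · exact absurd h hiso.1
    · exact ⟨h, h.trans b02_20, h.trans b02_01, h.trans (b02_01.trans b01_00)⟩
  · obtain rfl : m = 3 := by omega
    -- For m = 3 the excesses m - 2, 2 and m - 1, 1 are the same pair in the opposite order.
    have φ : Nonempty (treeB 4 4 2 0 ≃g treeB 4 4 0 1) :=
      (isBalancedTree_treeB (m := 3) (by omega)).nonempty_iso_of_hasProfile
        (isBalancedTree_treeB (by omega)) (x := .inl 0) (by simp) treeB_degree_hub (x' := .inl 0)
        (by simp) treeB_degree_hub p20.swap p01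
    refine ⟨φ, ?_, ?_, ?_⟩
    · simp only [List.mem_cons, List.not_mem_nil, or_false]
      rintro G (rfl | rfl | rfl) <;> exact hT _ _ (by omega)
    · simp [b02_01, b02_01.trans b01_00, b01_00]
    · intro V _ T hTT hiso
      simp only [List.mem_cons, List.not_mem_nil, or_false, forall_eq_or_imp, forall_eq] at hiso ⊢
      obtain ⟨s, t, hst⟩ := hTT.exists_isBalancedTree
      rcases hst.nonempty_iso_or_sBefore hm with h | h | h | h | h
      · exact absurd h hiso.2.2
      · exact absurd h hiso.2.1
      · exact absurd ⟨h.some.trans φ.some⟩ hiso.2.1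
      · exact absurd h hiso.1
      · exact ⟨h, h.trans b02_01, h.trans (b02_01.trans b01_00)⟩
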